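/- **Theorem.** Let $p$ be an odd prime, $n\ge 1$, $q=p^n$, and let $\xi\in\mathbb F_{q^2}\setminus\mathbb F_q$; write each $x\in\mathbb F_{q^2}$ uniquely as $x=x_0+x_1\xi$ with $x_0,x_1\in\mathbb F_q$. A function $f:\mathbb F_{q^2}\to\mathbb F_{q^2}$ is *planar* if $x\mapsto f(x+a)-f(x)$ is bijective for every $a\neq 0$. Then $\Pi(f)$ denotes the projective plane with points $(x,y)\in\mathbb F_{q^2}^2$, $(a)$ for $a\in\mathbb F_{q^2}$, and $(\infty)$, and with lines $L_{a,b}=\{(x,f(x+a)-b):x\in\mathbb F_{q^2}\}\cup\{(a)\}$, $N_a=\{(a,y):y\in\mathbb F_{q^2}\}\cup\{(\infty)\}$, and $L_\infty=\{(a):a\in\mathbb F_{q^2}\cup\{\infty\}\}$. Put $$\mathcal U_\xi=\{(x,t\xi):x\in\mathbb F_{q^2},\ t\in\mathbb F_q\}\cup\{(\infty)\}.$$ A *unital* of order $q$ in $\Pi(f)$ is a set of $q^3+1$ points that meets every line in $1$ or $q+1$ points. In each of the cases (a)–(d), $f$ is planar, and so it is in case (e) exactly when $k$ is even. In each of the cases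 (a)–(e), if $f$ is planar, then $x*y=f(x+y)-f(x)-f(y)$ is the multiplication of a commutative presemifield on $(\mathbb F_{q^2},+)$, $\Pi(f)$ is isomorphic to the projective plane coordinatized by it, and $\mathcal U_\xi$ is a unital of order $q$ in $\Pi(f)$. - (a) (Dickson) $q\equiv 1\pmod 4$, $\alpha\in\mathbb F_q$ is a nonsquare, $0<i<n$, and $f(x)=(x_0^2+\alpha x_1^{2p^i})+2x_0x_1\xi$. - (b) (Pott–Zhou) $q\equiv 1\pmod 4$, $\alpha\in\mathbb F_q$ is a nonsquare, $0<i,k<n$, $n/\gcd(k,n)$ is odd, and $f(x)=(x_0^{p^k+1}+\alpha x_1^{p^{k+i}+p^i})+2x_0x_1\xi$. - (c) (Ganley) $p=3$, $n$ is odd, and $f(x)=(x_0^2+x_1^{10})+(2x_0x_1+x_1^6)\xi$. - (d) (Penttila–Williams) $p=3$, $n=5$, and $f(x)=(x_0^2+x_1^{18})+(2x_0x_1+x_1^{54})\xi$. - (e) (Budaghyan–Helleseth) $q\equiv 3\pmod 4$, $0<k<n$, $n/\gcd(k,n)$ is odd, $b$ is a nonsquare in $\mathbb F_{q^2}$, and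 $f(x)=bx^{p^k+1}+(bx^{p^k+1})^{q}+\xi x^{q+1}$. -/

import Mathlib

/-- `f` is a planar function: every difference map `x ↦ f (x + a) - f x`, `a ≠ 0`, is bijective. -/
def IsPlanar {F : Type*} [Field F] (f : F → F) : Prop :=
  ∀ a : F, a ≠ 0 → Function.Bijective (fun x => f (x + a) - f x)

/-- The points of the planes coordinatized by `F`: the affine points `(x, y)`, the points `(a)`
at infinity, and the point `(∞)`. -/
inductive PlanePoint (F : Type*) where
  | affine (x y : F) : PlanePoint F
  | slope (a : F) : PlanePoint F
  | infty : PlanePoint F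

namespace PlanePoint

/-- The line `N_a = {(a, y) : y ∈ F} ∪ {(∞)}`. -/
def vertical {F : Type*} (a : F) : Set (PlanePoint F) :=
  {P | ∃ y : F, P = affine a y} ∪ {infty}

/-- The line at infinity `L_∞ = {(a) : a ∈ F ∪ {∞}}`. -/
def lineInfty {F : Type*} : Set (PlanePoint F) :=
  {P | ∃ a : F, P = slope a} ∪ {infty}

/-- The line `L_{a,b} = {(x, f (x + a) - b) : x ∈ F} ∪ {(a)}` of the plane `Π(f)`. -/
def shiftLine {F : Type*} [Field F] (f : F → F) (a b : F) : Set (PlanePoint F) :=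
  {P | ∃ x : F, P = affine x (f (x + a) - b)} ∪ {slope a}

/-- The plane `Π(f)`, given by the collection of its lines. -/
def shiftPlane {F : Type*} [Field F] (f : F → F) : Set (Set (PlanePoint F)) :=
  {l | (∃ a b : F, l = shiftLine f a b) ∨ (∃ a : F, l = vertical a) ∨ l = lineInfty}

/-- The line `{(x, a * x + b) : x ∈ F} ∪ {(a)}` for a multiplication `mul` on `F`. -/
def presemifieldLine {F : Type*} [Field F] (mul : F → F → F) (a b : F) : Set (PlanePoint F) :=
  {P | ∃ x : F, P = affine x (mul a x + b)} ∪ {slope a}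

/-- The plane coordinatized by a multiplication `mul` on the additive group of `F`, given by the
collection of its lines. -/
def presemifieldPlane {F : Type*} [Field F] (mul : F → F → F) : Set (Set (PlanePoint F)) :=
  {l | (∃ a b : F, l = presemifieldLine mul a b) ∨ (∃ a : F, l = vertical a) ∨ l = lineInfty}

end PlanePoint

/-- Points lie on lines of a collection of point sets by set membership. -/
instance lineMembership {P : Type*} (lines : Set (Set P)) : Membership P lines :=
  ⟨fun l x => x ∈ (l : Set P)⟩

/-- A collection of point sets is the set of lines of a projective plane. -/
def IsProjectivePlane {P : Type*} (lines : Set (Set P)) : Prop :=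
  Nonempty (Configuration.ProjectivePlane P lines)

/-- Two planes are isomorphic: there is a bijection of the points that maps
lines to lines, in both directions. -/
def PlanesIsomorphic {P Q : Type*} (lines : Set (Set P)) (lines' : Set (Set Q)) : Prop :=
  ∃ φ : P ≃ Q, ∀ l : Set P, l ∈ lines ↔ φ '' l ∈ lines'

/-- `mul` is the multiplication of a commutative presemifield with the (finite) additive group of
`F`: it is commutative, distributive, and has no zero divisors. -/
structure IsCommPresemifield {F : Type*} [Field F] (mul : F → F → F) : Prop where
  comm : ∀ x y, mul x y = mul y x
  left_distrib : ∀ x y z, mul x (y + z) = mul x y + mul x z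
  no_zero_divisors : ∀ x y, mul x y = 0 → x = 0 ∨ y = 0

/-- `U` is a unital of order `m` embedded in the plane with the given lines: it has `m ^ 3 + 1`
points and every line meets it in `1` or `m + 1` points. -/
def IsEmbeddedUnital {P : Type*} (lines : Set (Set P)) (m : ℕ) (U : Set P) : Prop :=
  U.ncard = m ^ 3 + 1 ∧ ∀ l ∈ lines, (U ∩ l).ncard = 1 ∨ (U ∩ l).ncard = m + 1

/-- The set `U_θ = {(x, t θ) : x ∈ F, t ∈ K} ∪ {(∞)}`. -/
def unitalSet {F : Type*} [Field F] (K : Subfield F) (θ : F) : Set (PlanePoint F) :=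
  {P | ∃ (x : F) (t : K), P = PlanePoint.affine x ((t : F) * θ)} ∪ {PlanePoint.infty}

/-- `f` is a planar function, `Π(f)` is a projective plane, namely the plane of the commutative
presemifield with multiplication `x * y = f (x + y) - f x - f y`, and `U` is a unital of order `m`
in `Π(f)`. -/
structure IsUnitalInCommSemifieldPlane {F : Type*} [Field F] (f : F → F) (m : ℕ)
    (U : Set (PlanePoint F)) : Prop where
  planar : IsPlanar f
  projective : IsProjectivePlane (PlanePoint.shiftPlane f)
  presemifield : IsCommPresemifield (QuadraticMap.polar f)
  semifield_plane : PlanesIsomorphic (PlanePoint.shiftPlane f)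
    (PlanePoint.presemifieldPlane (QuadraticMap.polar f))
  unital : IsEmbeddedUnital (PlanePoint.shiftPlane f) m U

/-!
All the functions `f` are quadratic: with `q = p ^ n`, they are sums of products of additive maps.
Hence `polar f` is biadditive, and `f` is planar once `polar f x y = 0` forces `x = 0` or `y = 0`
(`isPlanar_of_polar`). A planar function gives a projective plane (`IsPlanar.isProjectivePlane`),
and the shear `(x, y) ↦ (x, y - f x)` carries it to the plane of `polar f`
(`planesIsomorphic_shiftPlane`).

Write `f = g + h ξ` with `g` and `h` taking values in `K`. A line `L_{a,b}` meets `U_ξ` in as many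
points as `g` has preimages of the `K`-component of `b`, so the unital property says that all
fibres of `g` have size `1` or `q + 1` (`isEmbeddedUnital_unitalSet`). This holds because in every
case `g` is, up to a permutation of `F` and a constant factor, the norm `z ↦ z ^ (q + 1)` from `F`
to `K` (`ncard_fiber_eq_of_norm`). In coordinates, `x₀ ^ 2 + α x₁ ^ 2` with `-α` a nonsquare is
the norm of `x₀ + x₁ √(-α)`; the trace form `b x ^ 2 + (b x ^ 2) ^ q` with `b` a nonsquare is a
multiple of the norm of `x - c x ^ q` for suitable `c` (`exists_trace_eq_norm`). Powers
`x ^ (s + 1)` in place of squares make no difference: if an odd iterate of the `s`-th power map is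
the identity and `s ≡ 1 (mod 4)`, then `x ^ ((s + 1) / 2)` permutes the field
(`pow_half_injective`).

That the polar forms have no zero divisors is a separate short computation for each family: a
nontrivial zero would make a nonsquare of `K` or `F` a square, or give a nonzero solution of
`z ^ s = -z`, which `eq_zero_of_pow_eq_neg` excludes. The Dickson functions are the case
`k = 0` of the Pott–Zhou functions.
-/

/-! ### The plane of a planar function -/

section Plane

variable {F : Type*}

namespace PlanePoint

@[simp] theorem affine_mem_vertical {a x y : F} : affine x y ∈ vertical a ↔ x = a := by
  simp [vertical]

@[simp] theorem slope_notMem_vertical {a c : F} : slope c ∉ vertical a := by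
  simp [vertical]

@[simp] theorem infty_mem_vertical {a : F} : infty ∈ vertical a := by
  simp [vertical]

@[simp] theorem affine_notMem_lineInfty {x y : F} :
    affine x y ∉ (lineInfty : Set (PlanePoint F)) := by
  simp [lineInfty]

@[simp] theorem slope_mem_lineInfty {c : F} : slope c ∈ (lineInfty : Set (PlanePoint F)) := by
  simp [lineInfty]

@[simp] theorem infty_mem_lineInfty : infty ∈ (lineInfty : Set (PlanePoint F)) := by
  simp [lineInfty]

variable [Field F]

@[simp] theorem affine_mem_shiftLine {f : F → F} {a b x y : F} :
    affine x y ∈ shiftLine f a b ↔ y = f (x + a) - b := by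
  simp only [shiftLine, Set.union_singleton, Set.mem_insert_iff, Set.mem_ofPred_eq, affine.injEq,
    reduceCtorEq, false_or]
  exact ⟨by rintro ⟨_, rfl, rfl⟩; rfl, fun h => ⟨x, rfl, h⟩⟩

@[simp] theorem slope_mem_shiftLine {f : F → F} {a b c : F} :
    slope c ∈ shiftLine f a b ↔ c = a := by
  simp [shiftLine]

@[simp] theorem infty_notMem_shiftLine {f : F → F} {a b : F} : infty ∉ shiftLine f a b := by
  simp [shiftLine]

@[simp] theorem affine_mem_presemifieldLine {mul : F → F → F} {a b x y : F} :
    affine x y ∈ presemifieldLine mul a b ↔ y = mul a x + b := by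
  simp only [presemifieldLine, Set.union_singleton, Set.mem_insert_iff, Set.mem_ofPred_eq,
    affine.injEq, reduceCtorEq, false_or]
  exact ⟨by rintro ⟨_, rfl, rfl⟩; rfl, fun h => ⟨x, rfl, h⟩⟩

@[simp] theorem slope_mem_presemifieldLine {mul : F → F → F} {a b c : F} :
    slope c ∈ presemifieldLine mul a b ↔ c = a := by
  simp [presemifieldLine]

@[simp] theorem infty_notMem_presemifieldLine {mul : F → F → F} {a b : F} :
    infty ∉ presemifieldLine mul a b := by
  simp [presemifieldLine]

theorem shiftLine_mem_shiftPlane (f : F → F) (a b : F) : shiftLine f a b ∈ shiftPlane f :=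
  .inl ⟨a, b, rfl⟩

theorem vertical_mem_shiftPlane (f : F → F) (a : F) : vertical a ∈ shiftPlane f :=
  .inr (.inl ⟨a, rfl⟩)

theorem lineInfty_mem_shiftPlane (f : F → F) : lineInfty ∈ shiftPlane f :=
  .inr (.inr rfl)

end PlanePoint

variable [Field F]

open PlanePoint

/-- For planar `f`, the equation `f (x + a) - f (x + b) = c` with `a ≠ b` has a unique
solution `x`. -/
theorem IsPlanar.existsUnique_sub_eq {f : F → F} (hf : IsPlanar f) {a b : F} (hab : a ≠ b) (c : F) :
    ∃! x, f (x + a) - f (x + b) = c := by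
  obtain ⟨z, hz, huniq⟩ := (hf (a - b) (sub_ne_zero.2 hab)).existsUnique c
  refine ⟨z - b, ?_, fun y hy => ?_⟩
  · rw [← hz]
    ring_nf
  · rw [← huniq (y + b) (by rw [← hy]; ring_nf), add_sub_cancel_right]

theorem IsPlanar.exists_mem_inter {f : F → F} (hf : IsPlanar f) {l m : Set (PlanePoint F)}
    (hl : l ∈ shiftPlane f) (hm : m ∈ shiftPlane f) (hlm : l ≠ m) : ∃ P, P ∈ l ∧ P ∈ m := by
  rcases hl with ⟨a, b, rfl⟩ | ⟨a, rfl⟩ | rfl <;> rcases hm with ⟨c, d, rfl⟩ | ⟨c, rfl⟩ | rfl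
  · by_cases hac : a = c
    · exact ⟨slope a, by simp [hac]⟩
    · obtain ⟨x, hx, -⟩ := hf.existsUnique_sub_eq hac (b - d)
      exact ⟨affine x (f (x + a) - b), by simp, by simp; linear_combination hx⟩
  · exact ⟨affine c (f (c + a) - b), by simp⟩
  · exact ⟨slope a, by simp⟩
  · exact ⟨affine a (f (a + c) - d), by simp⟩
  · exact ⟨infty, by simp⟩
  · exact ⟨infty, by simp⟩
  · exact ⟨slope c, by simp⟩
  · exact ⟨infty, by simp⟩
  · exact absurd rfl hlm

theorem IsPlanar.exists_line_through {f : F → F} (hf : IsPlanar f) (P Q : PlanePoint F) :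
    ∃ l ∈ shiftPlane f, P ∈ l ∧ Q ∈ l := by
  have hL := shiftLine_mem_shiftPlane f
  have hV := vertical_mem_shiftPlane f
  have hI := lineInfty_mem_shiftPlane f
  rcases P with ⟨x, y⟩ | c | _ <;> rcases Q with ⟨z, w⟩ | d | _
  · by_cases hxz : x = z
    · exact ⟨_, hV x, by simp [hxz]⟩
    · obtain ⟨a, ha, -⟩ := hf.existsUnique_sub_eq hxz (y - w)
      refine ⟨_, hL a (f (x + a) - y), by simp, ?_⟩
      simp only [affine_mem_shiftLine, add_comm _ a]
      linear_combination ha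
  · exact ⟨_, hL d (f (x + d) - y), by simp⟩
  · exact ⟨_, hV x, by simp⟩
  · exact ⟨_, hL c (f (z + c) - w), by simp⟩
  · exact ⟨_, hI, by simp⟩
  · exact ⟨_, hI, by simp⟩
  · exact ⟨_, hV z, by simp⟩
  · exact ⟨_, hI, by simp⟩
  · exact ⟨_, hI, by simp⟩

theorem IsPlanar.eq_or_eq {f : F → F} (hf : IsPlanar f) {P Q : PlanePoint F}
    {l m : Set (PlanePoint F)} (hl : l ∈ shiftPlane f) (hm : m ∈ shiftPlane f)
    (hPl : P ∈ l) (hQl : Q ∈ l) (hPm : P ∈ m) (hQm : Q ∈ m) : P = Q ∨ l = m := by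
  rcases hl with ⟨a, b, rfl⟩ | ⟨a, rfl⟩ | rfl <;> rcases hm with ⟨c, d, rfl⟩ | ⟨c, rfl⟩ | rfl <;>
    rcases P with ⟨x, y⟩ | s | _ <;> rcases Q with ⟨z, w⟩ | t | _ <;> simp_all
  · by_cases hac : a = c
    · right
      rw [hac, sub_right_inj] at hPm
      rw [hac, hPm]
    · left
      have hxz : x = z := (hf.existsUnique_sub_eq hac (b - d)).unique
        (by linear_combination hPm) (by linear_combination hQm)
      exact ⟨hxz, by rw [hxz]⟩

theorem IsPlanar.isProjectivePlane {f : F → F} (hf : IsPlanar f) :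
    IsProjectivePlane (shiftPlane f) := by
  have hL := shiftLine_mem_shiftPlane f
  have hV := vertical_mem_shiftPlane f
  have hI := lineInfty_mem_shiftPlane f
  have hpt : ∀ {l m : shiftPlane f}, l ≠ m → ∃ P : PlanePoint F, P ∈ l.1 ∧ P ∈ m.1 :=
    fun {l m} h => hf.exists_mem_inter l.2 m.2 (Subtype.coe_injective.ne h)
  have hln : ∀ {P Q : PlanePoint F}, P ≠ Q → ∃ l : shiftPlane f, P ∈ l.1 ∧ Q ∈ l.1 := by
    intro P Q _
    obtain ⟨l, hl, h⟩ := hf.exists_line_through P Q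
    exact ⟨⟨l, hl⟩, h⟩
  have hnd : Configuration.Nondegenerate (PlanePoint F) (shiftPlane f) :=
    { exists_point := by
        rintro ⟨l, ⟨a, b, rfl⟩ | ⟨a, rfl⟩ | rfl⟩
        · exact ⟨infty, infty_notMem_shiftLine⟩
        · exact ⟨slope 0, slope_notMem_vertical⟩
        · exact ⟨affine 0 0, affine_notMem_lineInfty⟩
      exists_line := by
        rintro (⟨x, y⟩ | c | _)
        · exact ⟨⟨_, hI⟩, affine_notMem_lineInfty⟩
        · exact ⟨⟨_, hV 0⟩, slope_notMem_vertical⟩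
        · exact ⟨⟨_, hL 0 0⟩, infty_notMem_shiftLine⟩
      eq_or_eq := fun {_ _ l m} h₁ h₂ h₃ h₄ =>
        (hf.eq_or_eq l.2 m.2 h₁ h₂ h₃ h₄).imp_right Subtype.ext }
  refine ⟨{ toNondegenerate := hnd
            mkPoint := fun h => (hpt h).choose
            mkPoint_ax := fun h => (hpt h).choose_spec
            mkLine := fun h => (hln h).choose
            mkLine_ax := fun h => (hln h).choose_spec
            exists_config := ?_ }⟩
  exact ⟨affine 1 0, infty, affine 0 1, ⟨_, hL 0 (f (0 + 0))⟩, ⟨_, hV 0⟩, ⟨_, hI⟩,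
    fun h => one_ne_zero (affine_mem_vertical.1 h), affine_notMem_lineInfty, infty_notMem_shiftLine,
    infty_mem_vertical, infty_mem_lineInfty, fun h => one_ne_zero ((affine_mem_shiftLine.1 h).trans
      (sub_self _)), affine_mem_vertical.2 rfl, affine_notMem_lineInfty⟩

/-- The shear `(x, y) ↦ (x, y - g x)`, fixing every point at infinity. -/
def PlanePoint.shear (g : F → F) : PlanePoint F ≃ PlanePoint F where
  toFun
    | affine x y => affine x (y - g x)
    | slope a => slope a
    | infty => infty
  invFun
    | affine x y => affine x (y + g x)
    | slope a => slope a
    | infty => infty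
  left_inv P := by cases P <;> simp
  right_inv P := by cases P <;> simp

theorem shear_image_shiftLine (f : F → F) (a b : F) :
    shear f '' shiftLine f a b = presemifieldLine (QuadraticMap.polar f) a (f a - b) := by
  ext P
  rw [Equiv.image_eq_preimage_symm]
  rcases P with ⟨x, y⟩ | c | _
  · simp only [shear, Equiv.coe_fn_symm_mk, Set.mem_preimage, affine_mem_shiftLine,
      affine_mem_presemifieldLine, QuadraticMap.polar, add_comm a x]
    constructor <;> intro h <;> linear_combination h
  · simp [shear]
  · simp [shear]

theorem shear_image_vertical (g : F → F) (a : F) : shear g '' vertical a = vertical a := by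
  ext P
  rw [Equiv.image_eq_preimage_symm]
  rcases P with ⟨x, y⟩ | c | _ <;> simp [shear]

theorem shear_image_lineInfty (g : F → F) : shear g '' lineInfty = lineInfty := by
  ext P
  rw [Equiv.image_eq_preimage_symm]
  rcases P with ⟨x, y⟩ | c | _ <;> simp [shear]

/-- The shear by `f` straightens the lines `L_{a,b}`, because
`f (x + a) - b - f x = polar f a x + (f a - b)`. -/
theorem planesIsomorphic_shiftPlane (f : F → F) :
    PlanesIsomorphic (shiftPlane f) (presemifieldPlane (QuadraticMap.polar f)) := by
  refine ⟨shear f, fun l => ⟨?_, ?_⟩⟩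
  · rintro (⟨a, b, rfl⟩ | ⟨a, rfl⟩ | rfl)
    · exact .inl ⟨_, _, shear_image_shiftLine f a b⟩
    · exact .inr (.inl ⟨a, shear_image_vertical f a⟩)
    · exact .inr (.inr (shear_image_lineInfty f))
  · have hinj := (shear f).injective.image_injective
    rintro (⟨a, b, h⟩ | ⟨a, h⟩ | h)
    · refine .inl ⟨a, f a - b, hinj ?_⟩
      rw [h, shear_image_shiftLine, sub_sub_cancel]
    · exact .inr (.inl ⟨a, hinj (h.trans (shear_image_vertical f a).symm)⟩)
    · exact .inr (.inr (hinj (h.trans (shear_image_lineInfty f).symm)))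

/-- On a finite field, a function with biadditive polar form is planar as soon as the polar form
has no zero divisors. -/
theorem isPlanar_of_polar [Finite F] {f : F → F}
    (hadd : ∀ x y z, QuadraticMap.polar f x (y + z) =
      QuadraticMap.polar f x y + QuadraticMap.polar f x z)
    (hzero : ∀ x y, QuadraticMap.polar f x y = 0 → x = 0 ∨ y = 0) : IsPlanar f := by
  intro a ha
  refine Function.Injective.bijective_of_finite fun x y hxy => ?_
  have hsub := hadd a (x - y) y
  rw [sub_add_cancel] at hsub
  have h0 : QuadraticMap.polar f a (x - y) = 0 := by
    simp only [QuadraticMap.polar, add_comm a] at hsub hxy ⊢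
    linear_combination hxy - hsub
  exact sub_eq_zero.1 ((hzero _ _ h0).resolve_left ha)

/-! ### Intersecting the set `U_ξ` with the lines -/

theorem ncard_unitalSet [Finite F] (K : Subfield F) {ξ : F} (hξ : ξ ≠ 0) {q : ℕ}
    (hK : Nat.card K = q) (hF : Nat.card F = q ^ 2) : (unitalSet K ξ).ncard = q ^ 3 + 1 := by
  have hU : {P | ∃ (x : F) (t : K), P = affine x ((t : F) * ξ)} =
      Set.range fun v : F × K => affine v.1 ((v.2 : F) * ξ) := by
    ext P
    simp [eq_comm]
  have hinj : Function.Injective fun v : F × K => affine v.1 ((v.2 : F) * ξ) := by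
    rintro ⟨x, s⟩ ⟨y, t⟩ h
    simpa [hξ] using h
  rw [unitalSet, Set.union_singleton, hU, Set.ncard_insert_of_notMem (by simp),
    Set.ncard_range_of_injective hinj, Nat.card_prod, hF, hK]
  ring

/-- A line `L_{a,b}` meets `U_ξ` in as many points as the `K`-component of `f` has preimages of
the `K`-component of `b`; the remaining lines meet `U_ξ` in `1` or `q + 1` points for every `f`. -/
theorem isEmbeddedUnital_unitalSet [Finite F] (K : Subfield F) {ξ : F} (hξ : ξ ∉ K) {q : ℕ}
    (hK : Nat.card K = q) (hF : Nat.card F = q ^ 2) {f : F → F} (g h : F → K)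
    (hf : ∀ x, f x = g x + h x * ξ)
    (hcoords : Function.Bijective fun v : K × K => (v.1 : F) + v.2 * ξ)
    (hg : ∀ c : K, {x | g x = c}.ncard = 1 ∨ {x | g x = c}.ncard = q + 1) :
    IsEmbeddedUnital (shiftPlane f) q (unitalSet K ξ) := by
  have hξ0 : ξ ≠ 0 := fun h => hξ (h ▸ K.zero_mem)
  refine ⟨ncard_unitalSet K hξ0 hK hF, ?_⟩
  rintro l (⟨a, b, rfl⟩ | ⟨a, rfl⟩ | rfl)
  · obtain ⟨⟨b₀, b₁⟩, rfl : (b₀ : F) + b₁ * ξ = b⟩ := hcoords.2 b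
    have himage : unitalSet K ξ ∩ shiftLine f a (b₀ + b₁ * ξ) =
        (fun x => affine (x - a) (f x - (b₀ + b₁ * ξ))) '' {x | g x = b₀} := by
      ext P
      simp only [unitalSet, Set.union_singleton, Set.mem_inter_iff, Set.mem_insert_iff,
        Set.mem_ofPred_eq, Set.mem_image]
      constructor
      · rintro ⟨rfl | ⟨x, t, rfl⟩, hP⟩
        · simp at hP
        · rw [affine_mem_shiftLine] at hP
          refine ⟨x + a, ?_, by rw [hP, add_sub_cancel_right]⟩
          have := @hcoords.1 (b₀, t + b₁) (g (x + a), h (x + a)) (by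
            simp only [← hf]
            push_cast
            linear_combination hP)
          exact (congrArg Prod.fst this).symm
      · rintro ⟨x, hx, rfl⟩
        refine ⟨.inr ⟨x - a, h x - b₁, ?_⟩, by simp⟩
        rw [hf, hx]
        push_cast
        ring_nf
    rw [himage, Set.ncard_image_of_injective _ fun x y hxy => by simpa using (affine.inj hxy).1]
    exact hg b₀
  · right
    have hrange : unitalSet K ξ ∩ vertical a =
        insert infty (Set.range fun t : K => affine a ((t : F) * ξ)) := by
      ext P
      rcases P with ⟨x, y⟩ | c | _ <;> simp [unitalSet, eq_comm, and_comm]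
    have hinj : Function.Injective fun t : K => affine a ((t : F) * ξ) := by
      intro s t h
      simpa [hξ0] using h
    rw [hrange, Set.ncard_insert_of_notMem (by simp), Set.ncard_range_of_injective hinj, hK]
  · left
    have hsingle : unitalSet K ξ ∩ lineInfty = {infty} := by
      ext P
      rcases P with ⟨x, y⟩ | c | _ <;> simp [unitalSet]
    rw [hsingle, Set.ncard_singleton]

end Plane

/-! ### Powers in finite fields -/

section Powers

/-- If the `s`-th power map interchanges `z` and `w`, then an odd iterate of it maps `z` to `w`. -/
theorem pow_pow_odd_of_swap {M : Type*} [Monoid M] {s N : ℕ} (hN : Odd N) {z w : M}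
    (hzw : z ^ s = w) (hwz : w ^ s = z) : z ^ s ^ N = w := by
  obtain ⟨m, rfl⟩ := hN
  induction m with
  | zero => simpa using hzw
  | succ m ih =>
    rw [show 2 * (m + 1) + 1 = 2 * m + 1 + 1 + 1 by ring, pow_succ s, pow_succ s, pow_mul, pow_mul,
      ih, hwz, hzw]

variable {L : Type*} [Field L] {s N : ℕ}

/-- If an odd iterate of the `s`-th power map is the identity, then that map has no eigenvector
with eigenvalue `-1`. -/
theorem eq_zero_of_pow_eq_neg (h2 : (2 : L) ≠ 0) (hs : Odd s) (hN : Odd N)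
    (hpow : ∀ y : L, y ^ s ^ N = y) {z : L} (hz : z ^ s = -z) : z = 0 := by
  have h := pow_pow_odd_of_swap hN hz (by rw [hs.neg_pow, hz, neg_neg])
  rw [hpow] at h
  exact (mul_eq_zero.1 (by linear_combination h : 2 * z = 0)).resolve_left h2

/-- If an odd iterate of the `s`-th power map is the identity and `s ≡ 1 (mod 4)`, then
`x ^ (s + 1)` is the square of the injective function `x ^ ((s + 1) / 2)`. -/
theorem pow_half_injective (h2 : (2 : L) ≠ 0) (hs : s % 4 = 1) (hN : Odd N)
    (hpow : ∀ y : L, y ^ s ^ N = y) : Function.Injective fun x : L => x ^ ((s + 1) / 2) := by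
  have he : Odd ((s + 1) / 2) := Nat.odd_iff.2 (by omega)
  intro x y hxy
  simp only at hxy
  rcases eq_or_ne y 0 with rfl | hy
  · exact eq_zero_of_pow_eq_zero (hxy.trans (zero_pow (by omega)))
  have hz : (x / y) ^ ((s + 1) / 2) = 1 := by
    rw [div_pow, hxy, div_self (pow_ne_zero _ hy)]
  set z := x / y with hzdef
  have hz0 : z ≠ 0 := by
    intro h
    rw [h, zero_pow (by omega)] at hz
    exact zero_ne_one hz
  have hzs : z ^ s = z⁻¹ := by
    refine eq_inv_of_mul_eq_one_left ?_
    rw [← pow_succ, show s + 1 = (s + 1) / 2 * 2 by omega, pow_mul, hz, one_pow]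
  have h := pow_pow_odd_of_swap hN hzs (by rw [inv_pow, hzs, inv_inv])
  rw [hpow] at h
  have hsq : z ^ 2 = 1 := by
    rw [pow_two]
    nth_rewrite 2 [h]
    exact mul_inv_cancel₀ hz0
  rcases sq_eq_sq_iff_eq_or_eq_neg.1 (hsq.trans (one_pow 2).symm) with h1 | h1
  · exact (div_eq_one_iff_eq hy).1 h1
  · rw [h1, he.neg_one_pow] at hz
    exact absurd (by linear_combination -hz : (2 : L) = 0) h2

theorem mod_four_eq_one_of_odd_pow (hN : Odd N) (h : s ^ N % 4 = 1) : s % 4 = 1 := by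
  obtain ⟨m, rfl⟩ := hN
  rw [pow_succ, pow_mul, Nat.mul_mod, Nat.pow_mod, Nat.pow_mod s 2] at h
  have : s % 4 < 4 := Nat.mod_lt _ (by norm_num)
  interval_cases hs : s % 4 <;> (simp_all; try omega)

theorem mul_div_gcd_eq (k n : ℕ) : k * (n / Nat.gcd k n) = n * (k / Nat.gcd k n) := by
  rw [← Nat.mul_div_assoc _ (Nat.gcd_dvd_right k n), ← Nat.mul_div_assoc _ (Nat.gcd_dvd_left k n),
    mul_comm]

theorem isSquare_neg_one_of_card_mod_four [Finite L] (h : Nat.card L % 4 = 1) :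
    IsSquare (-1 : L) := by
  have := Fintype.ofFinite L
  rw [FiniteField.isSquare_neg_one_iff, ← Nat.card_eq_fintype_card, h]
  norm_num

theorem not_isSquare_neg_one_of_card_mod_four [Finite L] (h : Nat.card L % 4 = 3) :
    ¬ IsSquare (-1 : L) := by
  have := Fintype.ofFinite L
  rw [FiniteField.isSquare_neg_one_iff, ← Nat.card_eq_fintype_card, h]
  norm_num

theorem pow_natCard_pow [Finite L] (m : ℕ) (x : L) : x ^ Nat.card L ^ m = x := by
  have := Fintype.ofFinite L
  rw [Nat.card_eq_fintype_card, FiniteField.pow_card_pow]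

end Powers

/-! ### A quadratic extension of finite fields -/

section Quadratic

variable {F : Type*} [Field F] [Finite F] {K : Subfield F} {q : ℕ}

theorem mem_subfield_iff_pow_eq (hK : Nat.card K = q) {x : F} : x ∈ K ↔ x ^ q = x := by
  have hsub : (K : Set F) ⊆ {x | x ^ q = x} := fun x hx => by
    have h := congrArg Subtype.val (pow_natCard_pow 1 (⟨x, hx⟩ : K))
    rwa [pow_one, hK] at h
  have hq : 1 < q := hK ▸ Finite.one_lt_card
  have hP := FiniteField.X_pow_card_sub_X_ne_zero F hq
  have hroots : {x : F | x ^ q = x} =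
      (Polynomial.X ^ q - Polynomial.X : Polynomial F).rootSet F := by
    ext y
    simp [Polynomial.mem_rootSet, hP, sub_eq_zero]
  have hle : {x : F | x ^ q = x}.ncard ≤ (K : Set F).ncard := by
    rw [hroots, ← Nat.card_coe_set_eq (K : Set F)]
    refine (Polynomial.ncard_rootSet_le _ _).trans_eq ?_
    rw [FiniteField.X_pow_card_sub_X_natDegree_eq F hq]
    exact hK.symm
  exact Set.ext_iff.1 (Set.eq_of_subset_of_ncard_le hsub hle) x

theorem coords_bijective (hK : Nat.card K = q) (hF : Nat.card F = q ^ 2) {δ : F} (hδ : δ ∉ K) :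
    Function.Bijective fun v : K × K => (v.1 : F) + v.2 * δ := by
  refine Function.Injective.bijective_of_nat_card_le ?_ (by rw [Nat.card_prod, hK, hF, pow_two])
  rintro ⟨a, b⟩ ⟨c, d⟩ h
  simp only at h
  have hbd : b = d := by
    by_contra hbd
    have hne : ((b - d : K) : F) ≠ 0 := fun h0 => hbd (sub_eq_zero.1 (Subtype.ext h0))
    refine hδ ?_
    have : δ = ((c - a) / (b - d) : K) := by
      push_cast at hne ⊢
      rw [eq_div_iff hne]
      linear_combination h
    exact this ▸ SetLike.coe_mem _
  subst hbd
  exact Prod.ext (Subtype.ext (add_right_cancel h)) rfl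

/-- In a quadratic extension of finite fields of odd order, all elements of the base field are
squares. -/
theorem isSquare_of_mem_subfield (hK : Nat.card K = q) (hF : Nat.card F = q ^ 2) (hq : Odd q)
    {x : F} (hx : x ∈ K) : IsSquare x := by
  have := Fintype.ofFinite F
  rcases eq_or_ne x 0 with rfl | hx0
  · exact IsSquare.zero
  have hcard : Fintype.card F = q ^ 2 := by rw [← Nat.card_eq_fintype_card, hF]
  have hchar : ringChar F ≠ 2 := by
    intro h
    have := FiniteField.even_card_of_char_two h
    rw [hcard, ← Nat.even_iff] at this
    exact (Nat.not_even_iff_odd.2 hq.pow) this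
  obtain ⟨m, rfl⟩ := hq
  have hx1 : x ^ (2 * m) = 1 := by
    have := (mem_subfield_iff_pow_eq hK).1 hx
    exact mul_right_cancel₀ hx0 (by rw [← pow_succ, this, one_mul])
  rw [FiniteField.isSquare_iff hchar hx0, hcard,
    show (2 * m + 1) ^ 2 / 2 = 2 * m * (m + 1) by
      rw [show (2 * m + 1) ^ 2 = 2 * (2 * m * (m + 1)) + 1 by ring]; omega,
    pow_mul, hx1, one_pow]

theorem pow_succ_mem_subfield (hK : Nat.card K = q) (hF : Nat.card F = q ^ 2) (z : F) :
    z ^ (q + 1) ∈ K := by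
  rw [mem_subfield_iff_pow_eq hK, ← pow_mul, show (q + 1) * q = q ^ 2 + q by ring, pow_add]
  have := pow_natCard_pow 1 z
  rw [pow_one, hF] at this
  rw [this, pow_succ']

/-- All fibres of the norm over nonzero elements have exactly `q + 1` elements: they have at most
that many, and together they exhaust the `q ^ 2 - 1 = (q - 1) * (q + 1)` units. -/
theorem ncard_norm_fiber (hK : Nat.card K = q) (hF : Nat.card F = q ^ 2) {c : F} (hc : c ∈ K)
    (hc0 : c ≠ 0) : {z : F | z ^ (q + 1) = c}.ncard = q + 1 := by
  classical
  have := Fintype.ofFinite F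
  let S : Finset F := Finset.univ.erase 0
  let T : Finset F := (Finset.univ.filter (· ∈ K)).erase 0
  have hS : S.card = q ^ 2 - 1 := by
    rw [Finset.card_erase_of_mem (Finset.mem_univ _), Finset.card_univ, ← Nat.card_eq_fintype_card,
      hF]
  have hT : T.card = q - 1 := by
    rw [Finset.card_erase_of_mem (by simp), ← Fintype.card_subtype, ← Nat.card_eq_fintype_card]
    exact congrArg (· - 1) hK
  have hmaps : ∀ z ∈ S, z ^ (q + 1) ∈ T := fun z hz =>
    Finset.mem_erase.2 ⟨pow_ne_zero _ (Finset.ne_of_mem_erase hz),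
      Finset.mem_filter.2 ⟨Finset.mem_univ _, pow_succ_mem_subfield hK hF z⟩⟩
  have hle : ∀ d ∈ T, (S.filter (· ^ (q + 1) = d)).card ≤ q + 1 := fun d _ => by
    have hsub : S.filter (· ^ (q + 1) = d) ⊆ (Polynomial.nthRoots (q + 1) d).toFinset := by
      intro z hz
      simpa [Polynomial.mem_nthRoots] using (Finset.mem_filter.1 hz).2
    exact (Finset.card_le_card hsub).trans
      ((Multiset.toFinset_card_le _).trans (Polynomial.card_nthRoots _ _))
  have hsum : ∑ d ∈ T, (S.filter (· ^ (q + 1) = d)).card = ∑ _d ∈ T, (q + 1) := by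
    rw [← Finset.card_eq_sum_card_fiberwise hmaps, Finset.sum_const, hS, hT, smul_eq_mul, mul_comm,
      ← Nat.sq_sub_sq, one_pow]
  have hcT : c ∈ T := by simp [T, hc, hc0]
  refine Eq.trans ?_ ((Finset.sum_eq_sum_iff_of_le hle).1 hsum c hcT)
  rw [← Set.ncard_coe_finset]
  refine congrArg Set.ncard (Set.ext fun z => ?_)
  simp only [Set.mem_ofPred_eq, Finset.coe_filter, S, Finset.mem_erase, Finset.mem_univ, and_true]
  refine ⟨fun h => ⟨?_, h⟩, And.right⟩
  rintro rfl
  exact hc0 (by simpa using h.symm)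

/-- A function that is the norm up to a constant factor and a permutation of `F` takes the value
zero once and all other values `q + 1` times. -/
theorem ncard_fiber_eq_of_norm (hK : Nat.card K = q) (hF : Nat.card F = q ^ 2) {g : F → K}
    {T : F → F} (hT : Function.Injective T) {κ : F} (hκ : κ ≠ 0)
    (hg : ∀ x, (g x : F) = κ * T x ^ (q + 1)) (c : K) :
    {x | g x = c}.ncard = 1 ∨ {x | g x = c}.ncard = q + 1 := by
  have hbij : Function.Bijective T := hT.bijective_of_finite
  have hκK : κ ∈ K := by
    obtain ⟨x, hx⟩ := hbij.2 1
    have := hg x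
    rw [hx, one_pow, mul_one] at this
    exact this ▸ (g x).2
  have hset : {x | g x = c} = T ⁻¹' {z | z ^ (q + 1) = c / κ} := by
    ext x
    simp only [Set.mem_ofPred_eq, Set.mem_preimage]
    rw [eq_div_iff hκ, mul_comm, ← hg, Subtype.coe_inj]
  rw [hset, Set.ncard_preimage_of_injective_subset_range hT (by simp [hbij.2.range_eq])]
  rcases eq_or_ne c 0 with rfl | hc
  · left
    simp [Set.ncard_singleton]
  · right
    exact ncard_norm_fiber hK hF (K.div_mem c.2 hκK)
      (div_ne_zero (fun h => hc (Subtype.ext h)) hκ)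

end Quadratic

/-! ### Functions given in coordinates over the subfield -/

section Coordinates

variable {F : Type*} [Field F] [Finite F] {K : Subfield F} {q : ℕ} {ξ : F}

/-- The properties to be proved for `f`, once its polar form is biadditive without zero divisors
and its `K`-component `g` has fibres of sizes `1` and `q + 1`. -/
theorem isUnitalInCommSemifieldPlane_of_fibers (hK : Nat.card K = q) (hF : Nat.card F = q ^ 2)
    (hξ : ξ ∉ K) {f : F → F} (g h : F → K) (hf : ∀ x, f x = g x + h x * ξ)
    (hadd : ∀ x y z, QuadraticMap.polar f x (y + z) =
      QuadraticMap.polar f x y + QuadraticMap.polar f x z)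
    (hzero : ∀ x y, QuadraticMap.polar f x y = 0 → x = 0 ∨ y = 0)
    (hg : ∀ c : K, {x | g x = c}.ncard = 1 ∨ {x | g x = c}.ncard = q + 1) :
    IsUnitalInCommSemifieldPlane f q (unitalSet K ξ) where
  planar := isPlanar_of_polar hadd hzero
  projective := (isPlanar_of_polar hadd hzero).isProjectivePlane
  presemifield := ⟨QuadraticMap.polar_comm f, hadd, hzero⟩
  semifield_plane := planesIsomorphic_shiftPlane f
  unital := isEmbeddedUnital_unitalSet K hξ hK hF g h hf (coords_bijective hK hF hξ) hg

/-- If the first component of `f` is the quadratic form `x₀ ^ 2 + α * x₁ ^ 2`, with `-α` a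
nonsquare of `K`, up to permutations of `K` in each variable, then it is a norm form up to a
permutation of `F`: with `δ ^ 2 = -α` one has `a ^ 2 + α * b ^ 2 = (a + b * δ) ^ (q + 1)`. -/
theorem isUnitalInCommSemifieldPlane_of_coords {p n : ℕ} [Fact p.Prime] [CharP F p] (hp2 : p ≠ 2)
    (hq : p ^ n = q) (hK : Nat.card K = q) (hF : Nat.card F = q ^ 2) (hξ : ξ ∉ K) {f : F → F}
    (G H : K × K → K) (hf : ∀ x₀ x₁ : K, f (x₀ + x₁ * ξ) = G (x₀, x₁) + H (x₀, x₁) * ξ)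
    (hG : ∀ x y z, QuadraticMap.polar G x (y + z) =
      QuadraticMap.polar G x y + QuadraticMap.polar G x z)
    (hH : ∀ x y z, QuadraticMap.polar H x (y + z) =
      QuadraticMap.polar H x y + QuadraticMap.polar H x z)
    (hzero : ∀ x y, QuadraticMap.polar G x y = 0 → QuadraticMap.polar H x y = 0 → x = 0 ∨ y = 0)
    {α : K} (hα : ¬ IsSquare (-α)) {ψ₀ ψ₁ : K → K} (hψ₀ : Function.Injective ψ₀)
    (hψ₁ : Function.Injective ψ₁) (hnorm : ∀ v, G v = ψ₀ v.1 ^ 2 + α * ψ₁ v.2 ^ 2) :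
    IsUnitalInCommSemifieldPlane f q (unitalSet K ξ) := by
  have hbij := coords_bijective hK hF hξ
  let e : K × K ≃+ F := AddEquiv.mk' (Equiv.ofBijective _ hbij) fun v w => by
    simp only [Equiv.ofBijective_apply, Prod.fst_add, Prod.snd_add]
    push_cast
    ring
  have he : ∀ v, e v = (v.1 : F) + v.2 * ξ := fun _ => rfl
  have hfe : ∀ v, f (e v) = G v + H v * ξ := fun v => hf v.1 v.2
  have hfe' : ∀ x, f x = G (e.symm x) + H (e.symm x) * ξ := fun x => by
    rw [← hfe, e.apply_symm_apply]
  have hpolar : ∀ x y, QuadraticMap.polar f x y =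
      e (QuadraticMap.polar G (e.symm x) (e.symm y),
        QuadraticMap.polar H (e.symm x) (e.symm y)) := by
    intro x y
    simp only [QuadraticMap.polar, he, hfe', map_add]
    push_cast
    ring
  refine isUnitalInCommSemifieldPlane_of_fibers hK hF hξ (fun x => G (e.symm x))
    (fun x => H (e.symm x)) hfe' ?_ ?_ ?_
  · intro x y z
    rw [hpolar, hpolar, hpolar, map_add e.symm, hG, hH, ← map_add]
    rfl
  · intro x y hxy
    rw [hpolar, map_eq_zero_iff e e.injective, Prod.mk_eq_zero] at hxy
    exact (hzero _ _ hxy.1 hxy.2).imp (fun h => (map_eq_zero_iff _ e.symm.injective).1 h)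
      fun h => (map_eq_zero_iff _ e.symm.injective).1 h
  · have hodd : Odd q := hq ▸ ((Fact.out : p.Prime).odd_of_ne_two hp2).pow
    obtain ⟨δ, hδ⟩ := isSquare_of_mem_subfield hK hF hodd (K.neg_mem α.2)
    have hδK : δ ∉ K := fun h => hα ⟨⟨δ, h⟩, Subtype.ext hδ⟩
    have hfrob : ∀ c : K, (c : F) ^ q = c := fun c => (mem_subfield_iff_pow_eq hK).1 c.2
    -- `δ ^ q` is the other square root of `-α`, since `δ ∉ K`.
    have hδq : δ ^ q = -δ := by
      have h : (δ ^ q) ^ 2 = δ ^ 2 := by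
        rw [← pow_mul, mul_comm, pow_mul, pow_two δ, ← hδ]
        exact hfrob (-α)
      exact (sq_eq_sq_iff_eq_or_eq_neg.1 h).resolve_left
        fun h' => hδK ((mem_subfield_iff_pow_eq hK).2 h')
    have hδbij := coords_bijective hK hF hδK
    refine ncard_fiber_eq_of_norm hK hF (κ := 1)
      (T := fun x => (ψ₀ (e.symm x).1 : F) + ψ₁ (e.symm x).2 * δ) ?_ one_ne_zero ?_
    · intro x y hxy
      have h := @hδbij.1 (ψ₀ (e.symm x).1, ψ₁ (e.symm x).2) (ψ₀ (e.symm y).1, ψ₁ (e.symm y).2) hxy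
      rw [Prod.mk.injEq] at h
      exact e.symm.injective (Prod.ext (hψ₀ h.1) (hψ₁ h.2))
    · intro x
      have hadd : ∀ a b : F, (a + b) ^ q = a ^ q + b ^ q := fun a b =>
        hq ▸ add_pow_char_pow a b p n
      rw [hnorm, pow_succ _ q, hadd, mul_pow, hfrob, hfrob, hδq]
      push_cast
      linear_combination -(ψ₁ (e.symm x).2 : F) ^ 2 * hδ

end Coordinates

/-! ### The Dickson and Pott–Zhou semifields -/

section PottZhou

/-- The polar form of the two components of the Pott–Zhou function, with `s = p ^ k` and
`r = p ^ i`. If `x₁ y₁ ≠ 0`, put `t = x₀ / x₁ = -y₀ / y₁` and `w = x₁ ^ s y₁ + x₁ y₁ ^ s ≠ 0`;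
the first equation becomes `α w ^ r = t ^ (s + 1) w`, and `r - 1` and `s + 1` are even. -/
theorem pottZhou_polar_zero {L : Type*} [Field L] {α : L} (hα : ¬ IsSquare α) {r s : ℕ}
    (hr : Odd r) (hs : Odd s) (hneg : ∀ z : L, z ^ s = -z → z = 0) {x₀ x₁ y₀ y₁ : L}
    (h₁ : x₀ ^ s * y₀ + x₀ * y₀ ^ s + α * (x₁ ^ s * y₁ + x₁ * y₁ ^ s) ^ r = 0)
    (h₂ : x₀ * y₁ + x₁ * y₀ = 0) : (x₀ = 0 ∧ x₁ = 0) ∨ (y₀ = 0 ∧ y₁ = 0) := by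
  have hw : ∀ u v : L, u ^ s * v + u * v ^ s = 0 → u = 0 ∨ v = 0 := by
    intro u v huv
    by_contra! h
    have hz : (u / v) ^ s = -(u / v) := by
      rw [div_pow, div_eq_iff (pow_ne_zero _ h.2), neg_mul, div_mul_eq_mul_div, ← neg_div,
        eq_div_iff h.2]
      linear_combination huv
    exact div_ne_zero h.1 h.2 (hneg _ hz)
  have hs0 : s ≠ 0 := hs.pos.ne'
  have hr0 : r ≠ 0 := hr.pos.ne'
  rcases eq_or_ne y₁ 0 with rfl | hy₁
  · rcases eq_or_ne y₀ 0 with rfl | hy₀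
    · exact .inr ⟨rfl, rfl⟩
    · have hx₁ : x₁ = 0 := (mul_eq_zero.1 (by simpa using h₂)).resolve_right hy₀
      subst hx₁
      simp only [mul_zero, zero_pow hs0, add_zero, zero_pow hr0] at h₁
      exact .inl ⟨(hw _ _ h₁).resolve_right hy₀, rfl⟩
  rcases eq_or_ne x₁ 0 with rfl | hx₁
  · exact .inl ⟨(mul_eq_zero.1 (by simpa using h₂)).resolve_right hy₁, rfl⟩
  exfalso
  obtain ⟨t, rfl⟩ : ∃ t, x₀ = t * x₁ := ⟨x₀ / x₁, (div_mul_cancel₀ _ hx₁).symm⟩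
  obtain rfl : y₀ = -(t * y₁) := mul_left_cancel₀ hx₁ (by linear_combination h₂)
  rw [hs.neg_pow, mul_pow, mul_pow] at h₁
  set w := x₁ ^ s * y₁ + x₁ * y₁ ^ s with hwdef
  have hw0 : w ≠ 0 := fun h => (hw _ _ h).elim hx₁ hy₁
  obtain ⟨j, rfl⟩ := hr
  obtain ⟨m, rfl⟩ := hs
  refine hα ⟨t ^ (m + 1) / w ^ j, ?_⟩
  have hpj := pow_ne_zero j hw0
  have key : α * (w ^ j * w ^ j) = t ^ (m + 1) * t ^ (m + 1) := by
    refine mul_right_cancel₀ hw0 ?_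
    have : t ^ (2 * m + 1) * t = t ^ (m + 1) * t ^ (m + 1) := by ring
    rw [← this, hwdef]
    rw [hwdef] at h₁
    linear_combination h₁
  field_simp
  linear_combination key

variable {F : Type*} [Field F] [Finite F] {K : Subfield F} {p n : ℕ} {ξ : F}

/-- The parameter `k = 0` gives the Dickson functions. -/
theorem isUnitalInCommSemifieldPlane_pottZhou [Fact p.Prime] [CharP F p] (hp2 : p ≠ 2)
    (hK : Nat.card K = p ^ n) (hF : Nat.card F = (p ^ n) ^ 2) (hξ : ξ ∉ K) (hq : p ^ n % 4 = 1)
    {α : K} (hα : ¬ IsSquare α) (i k : ℕ) (hk : Odd (n / Nat.gcd k n)) {f : F → F}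
    (hf : ∀ x₀ x₁ : K, f (x₀ + x₁ * ξ) =
      (x₀ ^ (p ^ k + 1) + α * x₁ ^ (p ^ (k + i) + p ^ i)) + 2 * x₀ * x₁ * ξ) :
    IsUnitalInCommSemifieldPlane f (p ^ n) (unitalSet K ξ) := by
  have hodd : Odd p := (Fact.out : p.Prime).odd_of_ne_two hp2
  have hcharK : CharP K p := (algebraMap K F).charP (algebraMap K F).injective p
  have h2 : (2 : K) ≠ 0 := Ring.two_ne_zero (by rwa [ringChar.eq K p])
  have hpow : ∀ y : K, y ^ (p ^ k) ^ (n / Nat.gcd k n) = y := fun y => by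
    rw [← pow_mul, mul_div_gcd_eq, pow_mul, ← hK, pow_natCard_pow]
  have hs : p ^ k % 4 = 1 := mod_four_eq_one_of_odd_pow hk (by
    rw [← pow_mul, mul_div_gcd_eq, pow_mul, Nat.pow_mod, hq, one_pow,
      Nat.one_mod])
  have hadd : ∀ (m : ℕ) (a b : K), (a + b) ^ p ^ m = a ^ p ^ m + b ^ p ^ m := fun m a b =>
    add_pow_char_pow a b p m
  let G : K × K → K := fun v => v.1 ^ (p ^ k + 1) + α * (v.2 ^ (p ^ k + 1)) ^ p ^ i
  let H : K × K → K := fun v => 2 * v.1 * v.2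
  have hG : ∀ v w, QuadraticMap.polar G v w = v.1 ^ p ^ k * w.1 + v.1 * w.1 ^ p ^ k +
      α * (v.2 ^ p ^ k * w.2 + v.2 * w.2 ^ p ^ k) ^ p ^ i := by
    intro v w
    simp only [QuadraticMap.polar, G, Prod.fst_add, Prod.snd_add, pow_succ, hadd, mul_pow]
    ring
  have hH : ∀ v w, QuadraticMap.polar H v w = 2 * (v.1 * w.2 + v.2 * w.1) := by
    intro v w
    simp only [QuadraticMap.polar, H, Prod.fst_add, Prod.snd_add]
    ring
  refine isUnitalInCommSemifieldPlane_of_coords hp2 rfl hK hF hξ G H ?_ ?_ ?_ ?_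
    (α := α) ?_ (ψ₀ := fun x => x ^ ((p ^ k + 1) / 2))
    (ψ₁ := fun x => (x ^ p ^ i) ^ ((p ^ k + 1) / 2)) ?_ ?_ ?_
  · intro x₀ x₁
    rw [hf]
    simp only [G, H]
    push_cast [show ((2 : K) : F) = 2 from rfl]
    ring
  · intro x y z
    simp only [hG, Prod.fst_add, Prod.snd_add, hadd, mul_pow]
    ring
  · intro x y z
    simp only [hH, Prod.fst_add, Prod.snd_add]
    ring
  · rintro ⟨x₀, x₁⟩ ⟨y₀, y₁⟩ h₁ h₂
    rw [hG] at h₁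
    rw [hH] at h₂
    simpa only [Prod.mk_eq_zero] using pottZhou_polar_zero hα hodd.pow hodd.pow
      (fun z => eq_zero_of_pow_eq_neg h2 hodd.pow hk hpow) h₁ ((mul_eq_zero.1 h₂).resolve_left h2)
  · intro hsq
    exact hα (by simpa using (isSquare_neg_one_of_card_mod_four (L := K) (hK ▸ hq)).mul hsq)
  · exact pow_half_injective h2 hs hk hpow
  · exact (pow_half_injective h2 hs hk hpow).comp (iterateFrobenius K p i).injective
  · intro v
    have he : p ^ k + 1 = (p ^ k + 1) / 2 * 2 := by omega
    simp only [G, ← pow_mul]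
    rw [mul_assoc, ← he, mul_comm (p ^ i)]

end PottZhou

/-! ### The Ganley and Penttila–Williams semifields -/

section Ternary

/-- With `u = x₁` and `v = y₁` nonzero, `a = x₀ / u` and `b = y₀ / v` have sum `-(u v) ^ 2` and
product `u ^ 8 + v ^ 8`. In characteristic three this gives `(a - b) ^ 2 = -(u ^ 4 + v ^ 4) ^ 2`. -/
theorem ganley_polar_zero {L : Type*} [Field L] [CharP L 3] (hneg : ¬ IsSquare (-1 : L))
    {x₀ x₁ y₀ y₁ : L} (h₁ : 2 * x₀ * y₀ + (x₁ ^ 9 * y₁ + x₁ * y₁ ^ 9) = 0)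
    (h₂ : x₀ * y₁ + x₁ * y₀ + x₁ ^ 3 * y₁ ^ 3 = 0) :
    (x₀ = 0 ∧ x₁ = 0) ∨ (y₀ = 0 ∧ y₁ = 0) := by
  have h3 : (3 : L) = 0 := CharP.cast_eq_zero L 3
  have h2 : (2 : L) ≠ 0 := fun h => one_ne_zero (by linear_combination h3 - h : (1 : L) = 0)
  rcases eq_or_ne y₁ 0 with rfl | hy₁
  · rcases eq_or_ne y₀ 0 with rfl | hy₀
    · exact .inr ⟨rfl, rfl⟩
    · simp_all
  rcases eq_or_ne x₁ 0 with rfl | hx₁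
  · simp_all
  exfalso
  obtain ⟨a, rfl⟩ : ∃ a, x₀ = a * x₁ := ⟨x₀ / x₁, (div_mul_cancel₀ _ hx₁).symm⟩
  obtain ⟨b, rfl⟩ : ∃ b, y₀ = b * y₁ := ⟨y₀ / y₁, (div_mul_cancel₀ _ hy₁).symm⟩
  have hxy := mul_ne_zero hx₁ hy₁
  have hprod : a * b = x₁ ^ 8 + y₁ ^ 8 :=
    mul_right_cancel₀ hxy (by linear_combination -h₁ + a * b * x₁ * y₁ * h3)
  have hsum : a + b = -(x₁ ^ 2 * y₁ ^ 2) := mul_right_cancel₀ hxy (by linear_combination h₂)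
  have hdisc : (a - b) ^ 2 = -(x₁ ^ 4 + y₁ ^ 4) ^ 2 := by
    linear_combination (a + b - x₁ ^ 2 * y₁ ^ 2) * hsum - 4 * hprod +
      (x₁ ^ 4 * y₁ ^ 4 - x₁ ^ 8 - y₁ ^ 8) * h3
  by_cases h4 : x₁ ^ 4 + y₁ ^ 4 = 0
  · refine hneg ⟨x₁ ^ 2 / y₁ ^ 2, ?_⟩
    field_simp
    linear_combination -h4
  · refine hneg ⟨(a - b) / (x₁ ^ 4 + y₁ ^ 4), ?_⟩
    field_simp
    linear_combination -hdisc

/-- In the field with `3 ^ 5` elements `w ^ 44 + 1` is a nonsquare for all `w ≠ 0`. Indeed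
`z = w ^ 44` satisfies `z ^ 11 = 1`, and the product of the factors `1 + z ^ r` over the
quadratic residues `r` modulo `11`, which is `(1 + z) ^ 121`, equals `-1`. -/
theorem one_add_pow_ne_sq {L : Type*} [Field L] [CharP L 3] [Finite L] (hL : Nat.card L = 3 ^ 5)
    {w : L} (hw : w ≠ 0) (d : L) : d ^ 2 ≠ w ^ 44 + 1 := by
  intro hd
  have h3 : (3 : L) = 0 := CharP.cast_eq_zero L 3
  have h2 : (2 : L) ≠ 0 := fun h => one_ne_zero (by linear_combination h3 - h : (1 : L) = 0)
  have hunit : ∀ y : L, y ≠ 0 → y ^ 242 = 1 := fun y hy => by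
    refine mul_right_cancel₀ hy ?_
    have := pow_natCard_pow 1 y
    rw [pow_one, hL] at this
    rw [← pow_succ, one_mul]
    exact this
  obtain ⟨z, hz⟩ : ∃ z, z = w ^ 44 := ⟨_, rfl⟩
  have hz11 : z ^ 11 = 1 := by
    rw [hz, ← pow_mul, show 44 * 11 = 242 * 2 by rfl, pow_mul, hunit w hw, one_pow]
  rw [← hz] at hd
  have hfrob : ∀ m : ℕ, (z + 1) ^ 3 ^ m = z ^ 3 ^ m + 1 := fun m => by
    have : Fact (Nat.Prime 3) := ⟨Nat.prime_three⟩
    rw [add_pow_char_pow, one_pow]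
  have h121 : (z + 1) ^ 121 = -1 := by
    have hsplit : (z + 1) ^ 121 = (z + 1) ^ 3 ^ 0 * (z + 1) ^ 3 ^ 1 * (z + 1) ^ 3 ^ 2 *
        (z + 1) ^ 3 ^ 3 * (z + 1) ^ 3 ^ 4 := by
      rw [← pow_add, ← pow_add, ← pow_add, ← pow_add]
      norm_num
    have h27 : z ^ 27 = z ^ 5 := by
      rw [show 27 = 11 * 2 + 5 by rfl, pow_add, pow_mul, hz11, one_pow, one_mul]
    have h81 : z ^ 81 = z ^ 4 := by
      rw [show 81 = 11 * 7 + 4 by rfl, pow_add, pow_mul, hz11, one_pow, one_mul]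
    rw [hsplit]
    simp only [hfrob]
    norm_num only [pow_one]
    rw [h27, h81]
    -- Modulo `z ^ 11 = 1` every power `1, z, ..., z ^ 10` occurs three times in the product, except
    -- that `1` occurs twice.
    linear_combination (1 + 2 * z + 3 * z ^ 2 + 2 * z ^ 3 + z ^ 4 + z ^ 5 + 2 * z ^ 6 + 2 * z ^ 7 +
      z ^ 8 + z ^ 10 + z ^ 11) * hz11 +
      (1 + z + z ^ 2 + z ^ 3 + z ^ 4 + z ^ 5 + z ^ 6 + z ^ 7 + z ^ 8 + z ^ 9 + z ^ 10) * h3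
  have hd0 : d ≠ 0 := by
    rintro rfl
    rw [← hd] at h121
    norm_num at h121
  rw [← hd, ← pow_mul, hunit d hd0] at h121
  exact h2 (by linear_combination h121)

/-- As in `ganley_polar_zero`, `a = x₀ / x₁` and `b = y₀ / y₁` have sum `-w ^ 26` and product
`-w ^ 8` with `w = x₁ y₁`, so that `(a - b) ^ 2 = w ^ 8 * (w ^ 44 + 1)`. -/
theorem penttilaWilliams_polar_zero {L : Type*} [Field L] [CharP L 3] [Finite L]
    (hL : Nat.card L = 3 ^ 5) {x₀ x₁ y₀ y₁ : L} (h₁ : x₀ * y₀ + x₁ ^ 9 * y₁ ^ 9 = 0)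
    (h₂ : x₀ * y₁ + x₁ * y₀ + x₁ ^ 27 * y₁ ^ 27 = 0) :
    (x₀ = 0 ∧ x₁ = 0) ∨ (y₀ = 0 ∧ y₁ = 0) := by
  have h3 : (3 : L) = 0 := CharP.cast_eq_zero L 3
  rcases eq_or_ne y₁ 0 with rfl | hy₁
  · rcases eq_or_ne y₀ 0 with rfl | hy₀
    · exact .inr ⟨rfl, rfl⟩
    · simp_all
  rcases eq_or_ne x₁ 0 with rfl | hx₁
  · simp_all
  exfalso
  obtain ⟨a, rfl⟩ : ∃ a, x₀ = a * x₁ := ⟨x₀ / x₁, (div_mul_cancel₀ _ hx₁).symm⟩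
  obtain ⟨b, rfl⟩ : ∃ b, y₀ = b * y₁ := ⟨y₀ / y₁, (div_mul_cancel₀ _ hy₁).symm⟩
  have hxy := mul_ne_zero hx₁ hy₁
  have hprod : a * b = -(x₁ * y₁) ^ 8 := mul_right_cancel₀ hxy (by linear_combination h₁)
  have hsum : a + b = -(x₁ * y₁) ^ 26 := mul_right_cancel₀ hxy (by linear_combination h₂)
  set w := x₁ * y₁
  refine one_add_pow_ne_sq hL hxy ((a - b) / w ^ 4) ?_
  field_simp
  linear_combination (a + b - w ^ 26) * hsum - 4 * hprod + w ^ 8 * h3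

variable {F : Type*} [Field F] [Finite F] {K : Subfield F} {n : ℕ} {ξ : F}

theorem three_pow_mod_four (hn : Odd n) : 3 ^ n % 4 = 3 := by
  obtain ⟨m, rfl⟩ := hn
  rw [pow_succ, pow_mul, Nat.mul_mod, Nat.pow_mod]
  norm_num

theorem isUnitalInCommSemifieldPlane_ganley [CharP F 3] (hn : Odd n) (hK : Nat.card K = 3 ^ n)
    (hF : Nat.card F = (3 ^ n) ^ 2) (hξ : ξ ∉ K) {f : F → F}
    (hf : ∀ x₀ x₁ : K, f (x₀ + x₁ * ξ) = (x₀ ^ 2 + x₁ ^ 10) + (2 * x₀ * x₁ + x₁ ^ 6) * ξ) :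
    IsUnitalInCommSemifieldPlane f (3 ^ n) (unitalSet K ξ) := by
  have : Fact (Nat.Prime 3) := ⟨Nat.prime_three⟩
  have hcharK : CharP K 3 := (algebraMap K F).charP (algebraMap K F).injective 3
  have h2 : (2 : K) ≠ 0 := Ring.two_ne_zero (by rw [ringChar.eq K 3]; norm_num)
  have hneg : ¬ IsSquare (-1 : K) :=
    not_isSquare_neg_one_of_card_mod_four (by rw [hK, three_pow_mod_four hn])
  have hpow : ∀ y : K, y ^ 9 ^ n = y := fun y => by
    rw [show 9 ^ n = (3 ^ n) ^ 2 by rw [← pow_mul, mul_comm, pow_mul]; rfl, ← hK, pow_natCard_pow]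
  have hadd₃ : ∀ a b : K, (a + b) ^ 3 = a ^ 3 + b ^ 3 := fun a b => add_pow_char a b 3
  have hadd₉ : ∀ a b : K, (a + b) ^ 9 = a ^ 9 + b ^ 9 := fun a b => add_pow_char_pow a b 3 2
  let G : K × K → K := fun v => v.1 ^ 2 + v.2 ^ 9 * v.2
  let H : K × K → K := fun v => 2 * v.1 * v.2 + (v.2 ^ 3) ^ 2
  have hG : ∀ v w, QuadraticMap.polar G v w =
      2 * v.1 * w.1 + (v.2 ^ 9 * w.2 + v.2 * w.2 ^ 9) := by
    intro v w
    simp only [QuadraticMap.polar, G, Prod.fst_add, Prod.snd_add, hadd₉]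
    ring
  have hH : ∀ v w, QuadraticMap.polar H v w =
      2 * (v.1 * w.2 + v.2 * w.1 + v.2 ^ 3 * w.2 ^ 3) := by
    intro v w
    simp only [QuadraticMap.polar, H, Prod.fst_add, Prod.snd_add, hadd₃]
    ring
  refine isUnitalInCommSemifieldPlane_of_coords (p := 3) (by norm_num) rfl hK hF hξ G H ?_ ?_ ?_ ?_
    (α := 1) hneg (ψ₀ := id) (ψ₁ := fun x => x ^ ((9 + 1) / 2)) Function.injective_id ?_ ?_
  · intro x₀ x₁
    rw [hf]
    simp only [G, H]
    push_cast [show ((2 : K) : F) = 2 from rfl]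
    ring
  · intro x y z
    simp only [hG, Prod.fst_add, Prod.snd_add, hadd₉]
    ring
  · intro x y z
    simp only [hH, Prod.fst_add, Prod.snd_add, hadd₃]
    ring
  · rintro ⟨x₀, x₁⟩ ⟨y₀, y₁⟩ h₁ h₂
    rw [hG] at h₁
    rw [hH] at h₂
    simpa only [Prod.mk_eq_zero] using
      ganley_polar_zero hneg h₁ ((mul_eq_zero.1 h₂).resolve_left h2)
  · exact pow_half_injective h2 (by norm_num) hn hpow
  · intro v
    simp only [G, id]
    ring

theorem isUnitalInCommSemifieldPlane_penttilaWilliams [CharP F 3] (hK : Nat.card K = 3 ^ 5)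
    (hF : Nat.card F = (3 ^ 5) ^ 2) (hξ : ξ ∉ K) {f : F → F}
    (hf : ∀ x₀ x₁ : K, f (x₀ + x₁ * ξ) = (x₀ ^ 2 + x₁ ^ 18) + (2 * x₀ * x₁ + x₁ ^ 54) * ξ) :
    IsUnitalInCommSemifieldPlane f (3 ^ 5) (unitalSet K ξ) := by
  have : Fact (Nat.Prime 3) := ⟨Nat.prime_three⟩
  have hcharK : CharP K 3 := (algebraMap K F).charP (algebraMap K F).injective 3
  have h2 : (2 : K) ≠ 0 := Ring.two_ne_zero (by rw [ringChar.eq K 3]; norm_num)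
  have hneg : ¬ IsSquare (-1 : K) := not_isSquare_neg_one_of_card_mod_four (by rw [hK]; norm_num)
  have hadd₉ : ∀ a b : K, (a + b) ^ 9 = a ^ 9 + b ^ 9 := fun a b =>
    add_pow_char_pow a b 3 2
  have hadd₂₇ : ∀ a b : K, (a + b) ^ 27 = a ^ 27 + b ^ 27 := fun a b =>
    add_pow_char_pow a b 3 3
  let G : K × K → K := fun v => v.1 ^ 2 + (v.2 ^ 9) ^ 2
  let H : K × K → K := fun v => 2 * v.1 * v.2 + (v.2 ^ 27) ^ 2
  have hG : ∀ v w, QuadraticMap.polar G v w = 2 * (v.1 * w.1 + v.2 ^ 9 * w.2 ^ 9) := by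
    intro v w
    simp only [QuadraticMap.polar, G, Prod.fst_add, Prod.snd_add, hadd₉]
    ring
  have hH : ∀ v w, QuadraticMap.polar H v w =
      2 * (v.1 * w.2 + v.2 * w.1 + v.2 ^ 27 * w.2 ^ 27) := by
    intro v w
    simp only [QuadraticMap.polar, H, Prod.fst_add, Prod.snd_add, hadd₂₇]
    ring
  refine isUnitalInCommSemifieldPlane_of_coords (p := 3) (by norm_num) rfl hK hF hξ G H ?_ ?_ ?_ ?_
    (α := 1) hneg (ψ₀ := id) (ψ₁ := fun x => x ^ 9) Function.injective_id
    (iterateFrobenius K 3 2).injective ?_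
  · intro x₀ x₁
    rw [hf]
    simp only [G, H]
    push_cast [show ((2 : K) : F) = 2 from rfl]
    ring
  · intro x y z
    simp only [hG, Prod.fst_add, Prod.snd_add, hadd₉]
    ring
  · intro x y z
    simp only [hH, Prod.fst_add, Prod.snd_add, hadd₂₇]
    ring
  · rintro ⟨x₀, x₁⟩ ⟨y₀, y₁⟩ h₁ h₂
    rw [hG] at h₁
    rw [hH] at h₂
    simpa only [Prod.mk_eq_zero] using penttilaWilliams_polar_zero hK
      ((mul_eq_zero.1 h₁).resolve_left h2) ((mul_eq_zero.1 h₂).resolve_left h2)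
  · intro v
    simp only [G, id]
    ring

end Ternary

/-! ### The Budaghyan–Helleseth semifields -/

section BudaghyanHelleseth

theorem odd_of_pow_mod_four_eq_three {p n : ℕ} (h : p ^ n % 4 = 3) : Odd n := by
  by_contra hn
  obtain ⟨m, rfl⟩ := Nat.not_odd_iff_even.1 hn
  rw [pow_add, Nat.mul_mod] at h
  have : p ^ m % 4 < 4 := Nat.mod_lt _ (by norm_num)
  interval_cases p ^ m % 4 <;> simp_all

theorem pow_mod_four_eq_one_of_even {p k : ℕ} (hp : Odd p) (hk : Even k) : p ^ k % 4 = 1 := by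
  obtain ⟨m, rfl⟩ := hk
  rw [pow_add, Nat.mul_mod]
  have hodd := Nat.odd_iff.1 (hp.pow (n := m))
  have : p ^ m % 4 = 1 ∨ p ^ m % 4 = 3 := by omega
  rcases this with h | h <;> rw [h]

theorem mod_four_eq_three_of_odd_pow {p k : ℕ} (hp : p % 4 = 3) (hk : Odd k) : p ^ k % 4 = 3 := by
  obtain ⟨m, rfl⟩ := hk
  rw [pow_succ, pow_mul, Nat.mul_mod, Nat.pow_mod, Nat.pow_mod p 2, hp]
  norm_num

theorem pow_eq_neg_of_mul_self_eq_neg_one {R : Type*} [CommRing R] {z : R} (hz : -1 = z * z)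
    {m : ℕ} (hm : m % 4 = 3) : z ^ m = -z := by
  have h4 : z ^ 4 = 1 := by linear_combination (1 - z * z) * hz
  rw [show m = 4 * (m / 4) + 3 by omega, pow_add, pow_mul, h4, one_pow]
  linear_combination -z * hz

variable {F : Type*} [Field F] {K : Subfield F} {p n k : ℕ} {ξ b : F} {f : F → F}

theorem polar_budaghyanHelleseth [Fact p.Prime] [CharP F p]
    (hf : ∀ x : F, f x =
      b * x ^ (p ^ k + 1) + (b * x ^ (p ^ k + 1)) ^ (p ^ n) + ξ * x ^ (p ^ n + 1)) (x y : F) :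
    QuadraticMap.polar f x y =
      b * (x ^ p ^ k * y + x * y ^ p ^ k) + (b * (x ^ p ^ k * y + x * y ^ p ^ k)) ^ p ^ n +
        ξ * (x ^ p ^ n * y + x * y ^ p ^ n) := by
  simp only [QuadraticMap.polar, hf, pow_succ, add_pow_char_pow, mul_pow]
  ring

variable [Finite F]

/-- For odd `k`, a square root `z` of `-1` satisfies `z ^ (p ^ k) = z ^ (p ^ n) = -z`, so that the
polar form vanishes at `(z, 1)`. -/
theorem even_of_isPlanar_budaghyanHelleseth [Fact p.Prime] [CharP F p] (hp2 : p ≠ 2)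
    (hK : Nat.card K = p ^ n) (hF : Nat.card F = (p ^ n) ^ 2) (hq : p ^ n % 4 = 3)
    (hf : ∀ x : F, f x =
      b * x ^ (p ^ k + 1) + (b * x ^ (p ^ k + 1)) ^ (p ^ n) + ξ * x ^ (p ^ n + 1))
    (hplanar : IsPlanar f) : Even k := by
  by_contra hk
  rw [Nat.not_even_iff_odd] at hk
  have hodd : Odd p := (Fact.out : p.Prime).odd_of_ne_two hp2
  obtain ⟨z, hz⟩ := isSquare_of_mem_subfield hK hF hodd.pow (K.neg_mem K.one_mem)
  have hp4 : p % 4 = 3 := by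
    have h2 := Nat.odd_iff.1 hodd
    by_contra h3
    rw [Nat.pow_mod, show p % 4 = 1 by omega, one_pow] at hq
    omega
  have hpolar : QuadraticMap.polar f z 1 = 0 := by
    rw [polar_budaghyanHelleseth hf,
      pow_eq_neg_of_mul_self_eq_neg_one hz (mod_four_eq_three_of_odd_pow hp4 hk),
      pow_eq_neg_of_mul_self_eq_neg_one hz hq]
    simp [(Fact.out : p.Prime).ne_zero]
  have hf0 : f 0 = 0 := by simp [hf, (Fact.out : p.Prime).ne_zero]
  have hz0 : z = 0 := (hplanar 1 one_ne_zero).injective (by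
    simp only [QuadraticMap.polar] at hpolar
    simp only [hf0, zero_add]
    linear_combination hpolar)
  simp [hz0] at hz

/-- For a nonsquare `b` and `q ≡ 3 (mod 4)` the trace form `b x ^ 2 + (b x ^ 2) ^ q` is a multiple
of the norm of `x - c x ^ q`, where `c ^ 2 = -b ^ (q - 1)`. -/
theorem exists_trace_eq_norm {q : ℕ} (hK : Nat.card K = q) (hF : Nat.card F = q ^ 2)
    (hq : q % 4 = 3) (hsub : ∀ x y : F, (x - y) ^ q = x ^ q - y ^ q) (hb : ¬ IsSquare b) :
    ∃ (T : F → F) (κ : F), Function.Injective T ∧ κ ≠ 0 ∧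
      ∀ x, b * x ^ 2 + (b * x ^ 2) ^ q = κ * T x ^ (q + 1) := by
  have := Fintype.ofFinite F
  have hodd : Odd q := Nat.odd_iff.2 (by omega)
  have hcard : Fintype.card F = q ^ 2 := by rw [← Nat.card_eq_fintype_card, hF]
  have hchar : ringChar F ≠ 2 := by
    intro h
    have := FiniteField.even_card_of_char_two h
    rw [hcard, ← Nat.even_iff] at this
    exact (Nat.not_even_iff_odd.2 hodd.pow) this
  have h2 : (2 : F) ≠ 0 := Ring.two_ne_zero hchar
  have hb0 : b ≠ 0 := by
    rintro rfl
    exact hb IsSquare.zero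
  obtain ⟨z, hz⟩ := isSquare_of_mem_subfield hK hF hodd (K.neg_mem K.one_mem)
  have hzq := pow_eq_neg_of_mul_self_eq_neg_one hz hq
  obtain ⟨j, hj⟩ : ∃ j, q = 4 * j + 3 := ⟨q / 4, by omega⟩
  have hb1 : b ^ ((2 * j + 1) * (q + 1)) = -1 := by
    have hhalf : Fintype.card F / 2 = (2 * j + 1) * (q + 1) := by
      rw [hcard, hj, show (4 * j + 3) ^ 2 = 2 * ((2 * j + 1) * (4 * j + 3 + 1)) + 1 by ring]
      omega
    have h := FiniteField.pow_dichotomy hchar hb0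
    rw [← FiniteField.isSquare_iff hchar hb0, hhalf] at h
    exact h.resolve_left hb
  set c := z * b ^ (2 * j + 1) with hc
  have hcc : c ^ 2 * b = -b ^ q := by
    rw [hc, hj]
    linear_combination -b ^ (4 * j + 3) * hz
  have hcq : c ^ q * c = -1 := by
    rw [hc, mul_pow, hzq, ← pow_mul]
    rw [mul_add, mul_one, pow_add] at hb1
    linear_combination b ^ ((2 * j + 1) * q) * b ^ (2 * j + 1) * hz + hb1
  have hc0 : c ≠ 0 := by
    rintro h
    rw [h, mul_zero] at hcq
    exact one_ne_zero (neg_eq_zero.1 hcq.symm)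
  have hqq : ∀ x : F, (x ^ q) ^ q = x := fun x => by
    rw [← pow_mul, ← pow_two, ← hF]
    simpa using pow_natCard_pow 1 x
  refine ⟨fun x => x - c * x ^ q, b * c, fun x y hxy => ?_, mul_ne_zero hb0 hc0, fun x => ?_⟩
  · have h1 : x - y = c * (x - y) ^ q := by
      rw [hsub]
      simp only at hxy
      linear_combination hxy
    have h3 : (x - y) ^ q = c ^ q * (x - y) := by
      conv_lhs => rw [h1, mul_pow, hqq]
    rw [h3] at h1
    have h4 : 2 * (x - y) = 0 := by linear_combination h1 + (x - y) * hcq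
    exact sub_eq_zero.1 ((mul_eq_zero.1 h4).resolve_left h2)
  · have hxq : (x ^ 2) ^ q = (x ^ q) ^ 2 := by rw [← pow_mul, ← pow_mul, mul_comm]
    simp only [pow_succ _ q, hsub, mul_pow, hqq, hxq]
    linear_combination (x ^ q) ^ 2 * hcc + (b * x ^ 2 - b * c * x * x ^ q) * hcq

/-- If `z = x / y`, the vanishing of the second component of the polar form says `z ^ q = -z`.
Then `w = z ^ s + z` with `s = p ^ k` also satisfies `w ^ q = -w`, and the first component is
`w (β - β ^ q)` with `β = b y ^ (s + 1)`. As a nonsquare, `β` does not lie in `K`, so `w = 0`. -/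
theorem isUnitalInCommSemifieldPlane_budaghyanHelleseth [Fact p.Prime] [CharP F p] (hp2 : p ≠ 2)
    (hK : Nat.card K = p ^ n) (hF : Nat.card F = (p ^ n) ^ 2) (hξ : ξ ∉ K) (hq : p ^ n % 4 = 3)
    (hkn : Odd (n / Nat.gcd k n)) (hk : Even k) (hb : ¬ IsSquare b)
    (hf : ∀ x : F, f x =
      b * x ^ (p ^ k + 1) + (b * x ^ (p ^ k + 1)) ^ (p ^ n) + ξ * x ^ (p ^ n + 1)) :
    IsUnitalInCommSemifieldPlane f (p ^ n) (unitalSet K ξ) := by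
  have hodd : Odd p := (Fact.out : p.Prime).odd_of_ne_two hp2
  have h2 : (2 : F) ≠ 0 := Ring.two_ne_zero (by rwa [ringChar.eq F p])
  have hs := pow_mod_four_eq_one_of_even hodd hk
  have hpow : ∀ y : F, y ^ (p ^ k) ^ (n / Nat.gcd k n) = y := fun y => by
    have hd : Odd (Nat.gcd k n) :=
      (odd_of_pow_mod_four_eq_three hq).of_dvd_nat (Nat.gcd_dvd_right k n)
    obtain ⟨m, hm⟩ : Even (k / Nat.gcd k n) := by
      rw [← Nat.mul_div_cancel' (Nat.gcd_dvd_left k n), Nat.even_mul] at hk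
      exact hk.resolve_left (Nat.not_even_iff_odd.2 hd)
    rw [← pow_mul, mul_div_gcd_eq, hm, ← two_mul, ← mul_assoc, pow_mul, pow_mul, ← hF,
      pow_natCard_pow]
  have hadd : ∀ (m : ℕ) (x y : F), (x + y) ^ p ^ m = x ^ p ^ m + y ^ p ^ m := fun m x y =>
    add_pow_char_pow x y p m
  have hqq : ∀ x : F, (x ^ p ^ n) ^ p ^ n = x := fun x => by
    rw [← pow_mul, ← pow_two, ← hF]
    simpa using pow_natCard_pow 1 x
  have htrace : ∀ x : F, x + x ^ p ^ n ∈ K := fun x => by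
    rw [mem_subfield_iff_pow_eq hK, hadd, hqq, add_comm]
  refine isUnitalInCommSemifieldPlane_of_fibers hK hF hξ
    (fun x => ⟨_, htrace (b * x ^ (p ^ k + 1))⟩) (fun x => ⟨_, pow_succ_mem_subfield hK hF x⟩)
    (fun x => by rw [hf, mul_comm ξ]) ?_ ?_ ?_
  · intro x y z
    simp only [polar_budaghyanHelleseth hf, hadd, mul_pow]
    ring
  · intro x y hxy
    rw [polar_budaghyanHelleseth hf] at hxy
    have hnorm : x ^ p ^ n * y + x * y ^ p ^ n ∈ K := by
      have := htrace (x ^ p ^ n * y)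
      rwa [mul_pow, hqq] at this
    obtain ⟨h₁, h₂⟩ : b * (x ^ p ^ k * y + x * y ^ p ^ k) +
        (b * (x ^ p ^ k * y + x * y ^ p ^ k)) ^ p ^ n = 0 ∧ x ^ p ^ n * y + x * y ^ p ^ n = 0 := by
      have h := @(coords_bijective hK hF hξ).1
        (⟨_, htrace (b * (x ^ p ^ k * y + x * y ^ p ^ k))⟩, ⟨_, hnorm⟩) (0, 0) (by
          simp only [ZeroMemClass.coe_zero]
          linear_combination hxy)
      rw [Prod.mk.injEq, Subtype.ext_iff, Subtype.ext_iff] at h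
      exact h
    by_contra! hne
    obtain ⟨hx, hy⟩ := hne
    obtain ⟨z, rfl⟩ : ∃ z, x = z * y := ⟨x / y, (div_mul_cancel₀ _ hy).symm⟩
    have hzq : z ^ p ^ n = -z := by
      refine mul_right_cancel₀ (mul_ne_zero (pow_ne_zero (p ^ n) hy) hy) ?_
      rw [mul_pow] at h₂
      linear_combination h₂
    have hB : b * ((z * y) ^ p ^ k * y + z * y * y ^ p ^ k) =
        b * y ^ (p ^ k + 1) * (z ^ p ^ k + z) := by
      rw [mul_pow, pow_succ]
      ring
    have hwq : (z ^ p ^ k + z) ^ p ^ n = -(z ^ p ^ k + z) := by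
      rw [hadd, ← pow_mul, mul_comm, pow_mul, hzq, hodd.pow.neg_pow]
      ring
    rw [hB, mul_pow _ (z ^ p ^ k + z), hwq] at h₁
    have hs1 : p ^ k + 1 = (p ^ k + 1) / 2 * 2 := by omega
    have hβ : (b * y ^ (p ^ k + 1)) ^ p ^ n ≠ b * y ^ (p ^ k + 1) := by
      intro h
      obtain ⟨u, hu⟩ := isSquare_of_mem_subfield hK hF hodd.pow ((mem_subfield_iff_pow_eq hK).2 h)
      refine hb ⟨u / y ^ ((p ^ k + 1) / 2), ?_⟩
      have hy' := pow_ne_zero ((p ^ k + 1) / 2) hy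
      rw [hs1, pow_mul] at hu
      field_simp
      linear_combination hu
    have hw : z ^ p ^ k + z = 0 := by
      refine (mul_eq_zero.1 (?_ : (b * y ^ (p ^ k + 1) - (b * y ^ (p ^ k + 1)) ^ p ^ n) *
        (z ^ p ^ k + z) = 0)).resolve_left (sub_ne_zero.2 hβ.symm)
      linear_combination h₁
    refine hx ?_
    rw [eq_zero_of_pow_eq_neg h2 hodd.pow hkn hpow (eq_neg_of_add_eq_zero_left hw), zero_mul]
  · obtain ⟨T, κ, hT, hκ, hTκ⟩ := exists_trace_eq_norm hK hF hq
      (fun x y => sub_pow_char_pow x y n) hb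
    refine ncard_fiber_eq_of_norm hK hF (hT.comp (pow_half_injective h2 hs hkn hpow)) hκ fun x => ?_
    rw [Function.comp_apply, ← hTκ, ← pow_mul, show (p ^ k + 1) / 2 * 2 = p ^ k + 1 by omega]

end BudaghyanHelleseth

/-! ### The five families -/

/-- `F` is the field with `q ^ 2 = p ^ (2 * n)` elements and `K` its subfield with `q = p ^ n`
elements. As `ξ ∉ K`, every element of `F` is `x₀ + x₁ ξ` for unique `x₀ x₁ : K`, so that the
equations in the first four parts determine `f`. -/
theorem theorem2p5 {F : Type*} [Field F] [Finite F] (p n : ℕ) (hp : p.Prime) (hp2 : p ≠ 2)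
    (hn : 0 < n) (hF : Nat.card F = p ^ (2 * n)) (K : Subfield F) (hK : Nat.card K = p ^ n)
    (ξ : F) (hξ : ξ ∉ K) :
    -- Dickson
    (p ^ n % 4 = 1 → ∀ α : K, ¬ IsSquare α → ∀ i : ℕ, 0 < i → i < n →
      ∀ f : F → F,
        (∀ x₀ x₁ : K, f (x₀ + x₁ * ξ) = (x₀ ^ 2 + α * x₁ ^ (2 * p ^ i)) + 2 * x₀ * x₁ * ξ) →
        IsUnitalInCommSemifieldPlane f (p ^ n) (unitalSet K ξ)) ∧
    -- Pott and Zhou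
    (p ^ n % 4 = 1 → ∀ α : K, ¬ IsSquare α → ∀ i k : ℕ, 0 < i → i < n → 0 < k → k < n →
      Odd (n / Nat.gcd k n) →
      ∀ f : F → F,
        (∀ x₀ x₁ : K, f (x₀ + x₁ * ξ) =
          (x₀ ^ (p ^ k + 1) + α * x₁ ^ (p ^ (k + i) + p ^ i)) + 2 * x₀ * x₁ * ξ) →
        IsUnitalInCommSemifieldPlane f (p ^ n) (unitalSet K ξ)) ∧
    -- Ganley
    (p = 3 → Odd n →
      ∀ f : F → F,
        (∀ x₀ x₁ : K, f (x₀ + x₁ * ξ) = (x₀ ^ 2 + x₁ ^ 10) + (2 * x₀ * x₁ + x₁ ^ 6) * ξ) →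
        IsUnitalInCommSemifieldPlane f (p ^ n) (unitalSet K ξ)) ∧
    -- Penttila and Williams
    (p = 3 → n = 5 →
      ∀ f : F → F,
        (∀ x₀ x₁ : K, f (x₀ + x₁ * ξ) = (x₀ ^ 2 + x₁ ^ 18) + (2 * x₀ * x₁ + x₁ ^ 54) * ξ) →
        IsUnitalInCommSemifieldPlane f (p ^ n) (unitalSet K ξ)) ∧
    -- Budaghyan and Helleseth
    (p ^ n % 4 = 3 → ∀ k : ℕ, 0 < k → k < n → Odd (n / Nat.gcd k n) →
      ∀ b : F, ¬ IsSquare b →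
      ∀ f : F → F,
        (∀ x : F, f x =
          b * x ^ (p ^ k + 1) + (b * x ^ (p ^ k + 1)) ^ (p ^ n) + ξ * x ^ (p ^ n + 1)) →
        (IsPlanar f ↔ Even k) ∧
        (IsPlanar f → IsUnitalInCommSemifieldPlane f (p ^ n) (unitalSet K ξ))) := by
  have : Fact p.Prime := ⟨hp⟩
  have hF' : Nat.card F = (p ^ n) ^ 2 := by rw [hF, ← pow_mul, mul_comm]
  have hchar : CharP F p := by
    have := Fintype.ofFinite F
    exact charP_of_card_eq_prime_pow (Nat.card_eq_fintype_card.symm.trans hF)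
  refine ⟨?_, ?_, ?_, ?_, ?_⟩
  · intro hq α hα i _ _ f hf
    refine isUnitalInCommSemifieldPlane_pottZhou hp2 hK hF' hξ hq hα i 0 ?_ fun x₀ x₁ => ?_
    · rw [Nat.gcd_zero_left, Nat.div_self hn]
      exact odd_one
    · rw [hf, pow_zero, zero_add, two_mul (p ^ i)]
  · intro hq α hα i k _ _ _ _ hk f hf
    exact isUnitalInCommSemifieldPlane_pottZhou hp2 hK hF' hξ hq hα i k hk hf
  · rintro rfl hodd f hf
    exact isUnitalInCommSemifieldPlane_ganley hodd hK hF' hξ hf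
  · rintro rfl rfl f hf
    exact isUnitalInCommSemifieldPlane_penttilaWilliams hK hF' hξ hf
  · intro hq k _ _ hkn b hb f hf
    have heven := even_of_isPlanar_budaghyanHelleseth hp2 hK hF' hq hf
    have hunital := fun hk : Even k =>
      isUnitalInCommSemifieldPlane_budaghyanHelleseth hp2 hK hF' hξ hq hkn hk hb hf
    exact ⟨⟨heven, fun hk => (hunital hk).planar⟩, fun h => hunital (heven h)⟩
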